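/- Let $(\Omega,\mathcal F,\mathbb P)$ be an atomless probability space (every $A\in\mathcal F$ with $\mathbb P[A]>0$ contains some $B\in\mathcal F$ with $0<\mathbb P[B]<\mathbb P[A]$), and let $\Psi:[0,\infty)\to[0,\infty)$ be a finite Young function, i.e. a continuous, nondecreasing, convex function with $\Psi(0)=0$ and $\lim_{x\to\infty}\Psi(x)=\infty$. Let $$H^\Psi=\{X\in L^0(\Omega,\mathcal F,\mathbb P):\ \mathbb E[\Psi(c|X|)]<\infty\text{ for all }c>0\}$$ be the Orlicz heart. For $k=1,2,\dots$ put $\psi_k(x)=\Psi(k|x|)$, $x\in\mathbb R$, and let $\mathcal M_1^{(\psi_k)}$ be the set of all Borel probability measures $\mu$ on $\mathbb R$ with $\int\psi_k\,d\mu<\infty$ for every $k\ge 1$. The $(\psi_k)$-weak topology on $\mathcal M_1^{(\psi_k)}$ is the coarsest topology for which all maps $\mu\mapsto\int f\,d\mu$ are continuous, where $f:\mathbb R\to\mathbb R$ runs through the continuous functions with $\sup_{x\in\mathbb R}|f(x)/(1+\psi_k(x))|<\infty$ for some $k\ge 1$. Let $\rho:H^\Psi\to\mathbb R$ be a law-invariant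 convex risk measure (not necessarily monetary), i.e. a map such that * $\rho(X)\ge\rho(Y)$ for all $X,Y\in H^\Psi$ with $X\le Y$ $\mathbb P$-a.s.; * $\rho(\lambda X+(1-\lambda)Y)\le\lambda\rho(X)+(1-\lambda)\rho(Y)$ for all $X,Y\in H^\Psi$ and $\lambda\in[0,1]$; * $\rho(X)=\rho(Y)$ for all $X,Y\in H^\Psi$ with $\mathbb P\circ X^{-1}=\mathbb P\circ Y^{-1}$. Then the set $\mathcal M(H^\Psi)=\{\mathbb P\circ X^{-1}:X\in H^\Psi\}$ equals $\mathcal M_1^{(\psi_k)}$; there is exactly one map $\mathcal R_\rho:\mathcal M_1^{(\psi_k)}\to\mathbb R$ (the risk functional associated with $\rho$) with $\rho(X)=\mathcal R_\rho(\mathbb P\circ X^{-1})$ for all $X\in H^\Psi$; and $\mathcal R_\rho$ is continuous with respect to the $(\psi_k)$-weak topology. -/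

import Mathlib

open MeasureTheory Set
open scoped NNReal ENNReal

noncomputable section

namespace RiskFunctional

section GaugeWeak

variable {E ι : Type*} [TopologicalSpace E] [MeasurableSpace E]

/-- The space `C_φ` of all continuous `f : E → ℝ` with `sup_x |f x / (1 + φ x)| < ∞`. -/
def gaugeBounded (φ : E → ℝ≥0) : Set (E → ℝ) :=
  {f | Continuous f ∧ BddAbove (range fun x => |f x / (1 + (φ x : ℝ))|)}

/-- The set of all Borel probability measures `μ` on `E` with `∫ ψ k dμ < ∞` for every index `k`,
as a type of its own (it does not inherit the weak topology). -/
structure GaugeMeasure (ψ : ι → E → ℝ≥0) where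
  /-- The underlying probability measure. -/
  toProb : ProbabilityMeasure E
  lintegral_lt_top : ∀ k, ∫⁻ x, (ψ k x : ℝ≥0∞) ∂(toProb : Measure E) < ∞

/-- The `(ψ k)`-weak topology: the coarsest topology for which all maps `μ ↦ ∫ f dμ`, with
`f ∈ C_{ψ k}` for some `k`, are continuous. -/
instance gaugeWeakTopology (ψ : ι → E → ℝ≥0) : TopologicalSpace (GaugeMeasure ψ) :=
  ⨅ (k : ι) (f : gaugeBounded (ψ k)),
    TopologicalSpace.induced
      (fun μ : GaugeMeasure ψ => ∫ x, (f : E → ℝ) x ∂(μ.toProb : Measure E)) inferInstance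

end GaugeWeak

/-- A finite Young function: continuous, nondecreasing, convex `Ψ : ℝ₊ → ℝ₊` with `Ψ 0 = 0` and
`Ψ x → ∞` as `x → ∞`. -/
structure YoungFunction where
  /-- The underlying function. -/
  toFun : ℝ≥0 → ℝ≥0
  continuous' : Continuous toFun
  monotone' : Monotone toFun
  convex' : ConvexOn ℝ≥0 univ toFun
  map_zero' : toFun 0 = 0
  tendsto' : Filter.Tendsto toFun Filter.atTop Filter.atTop

instance : CoeFun YoungFunction (fun _ => ℝ≥0 → ℝ≥0) := ⟨YoungFunction.toFun⟩

/-- The gauge functions `ψ_k = Ψ(k |·|)` on `ℝ`, `k = 1, 2, …`. -/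
def orliczGauge (Ψ : YoungFunction) (k : ℕ+) (x : ℝ) : ℝ≥0 :=
  Ψ (((k : ℕ) : ℝ≥0) * ‖x‖₊)

/-- Every set of positive measure has a measurable subset of strictly smaller positive measure.
(This is stronger than all singletons being null sets.) -/
def Atomless {Ω : Type*} [MeasurableSpace Ω] (P : Measure Ω) : Prop :=
  ∀ A, MeasurableSet A → 0 < P A → ∃ B ⊆ A, MeasurableSet B ∧ 0 < P B ∧ P B < P A

section Orlicz

variable {Ω : Type*} [MeasurableSpace Ω]

theorem YoungFunction.add_le (Ψ : YoungFunction) (a b : ℝ≥0) :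
    Ψ (a + b) ≤ Ψ (2 * a) + Ψ (2 * b) := by
  rcases le_total a b with h | h
  · exact (Ψ.monotone' (by rw [two_mul]; gcongr)).trans le_add_self
  · exact (Ψ.monotone' (by rw [two_mul]; gcongr)).trans le_self_add

/-- The Orlicz heart `H^Ψ` of all (classes of) random variables `X` with `E[Ψ(c|X|)] < ∞` for every
`c > 0`, a linear subspace of `L⁰`. -/
def orliczHeart (P : Measure Ω) (Ψ : YoungFunction) : Submodule ℝ (Ω →ₘ[P] ℝ) where
  carrier := {X | ∀ c : ℝ≥0, 0 < c → ∫⁻ ω, (Ψ (c * ‖X ω‖₊) : ℝ≥0∞) ∂P < ∞}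
  zero_mem' := by
    intro c _
    have h : ∀ᵐ ω ∂P, (Ψ (c * ‖(0 : Ω →ₘ[P] ℝ) ω‖₊) : ℝ≥0∞) = 0 := by
      filter_upwards [AEEqFun.coeFn_zero (α := Ω) (β := ℝ) (μ := P)] with ω hω
      simp [hω, Ψ.map_zero']
    simp [lintegral_congr_ae h]
  add_mem' := by
    intro X Y hX hY c hc
    have hc2 : 0 < 2 * c := by positivity
    have hm : Measurable fun ω => (Ψ (2 * c * ‖X ω‖₊) : ℝ≥0∞) :=
      (Ψ.continuous'.measurable.comp
        (measurable_const.mul X.measurable.nnnorm)).coe_nnreal_ennreal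
    have h : ∀ᵐ ω ∂P, (Ψ (c * ‖(X + Y) ω‖₊) : ℝ≥0∞) ≤
        Ψ (2 * c * ‖X ω‖₊) + Ψ (2 * c * ‖Y ω‖₊) := by
      filter_upwards [AEEqFun.coeFn_add X Y] with ω hω
      rw [hω, Pi.add_apply]
      norm_cast
      calc Ψ (c * ‖X ω + Y ω‖₊) ≤ Ψ (c * ‖X ω‖₊ + c * ‖Y ω‖₊) :=
            Ψ.monotone' (by rw [← mul_add]; gcongr; exact nnnorm_add_le _ _)
        _ ≤ _ := by simpa [mul_assoc] using Ψ.add_le (c * ‖X ω‖₊) (c * ‖Y ω‖₊)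
    refine (lintegral_mono_ae h).trans_lt ?_
    rw [lintegral_add_left hm]
    exact ENNReal.add_lt_top.2 ⟨hX _ hc2, hY _ hc2⟩
  smul_mem' := by
    intro a X hX c hc
    refine lt_of_le_of_lt (lintegral_mono_ae ?_) (hX (c * (‖a‖₊ + 1)) (by positivity))
    filter_upwards [AEEqFun.coeFn_smul a X] with ω hω
    rw [hω, Pi.smul_apply, nnnorm_smul, ← mul_assoc]
    have : ‖a‖₊ ≤ ‖a‖₊ + 1 := le_self_add
    exact_mod_cast Ψ.monotone' (by gcongr)

/-- The law `P ∘ X⁻¹` of a random variable. -/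
def law (P : Measure Ω) [IsProbabilityMeasure P] (X : Ω →ₘ[P] ℝ) : ProbabilityMeasure ℝ :=
  ⟨P.map X, Measure.isProbabilityMeasure_map X.aemeasurable⟩

/-- The law of an element of `H^Ψ`, as an element of `M_1^{(ψ_k)}`. -/
def heartLaw (P : Measure Ω) [IsProbabilityMeasure P] (Ψ : YoungFunction)
    (X : orliczHeart P Ψ) : GaugeMeasure (orliczGauge Ψ) where
  toProb := law P X
  lintegral_lt_top := by
    intro k
    have hm : Measurable fun x : ℝ => (orliczGauge Ψ k x : ℝ≥0∞) :=
      (Ψ.continuous'.measurable.comp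
        (measurable_const.mul measurable_nnnorm)).coe_nnreal_ennreal
    change ∫⁻ x, (orliczGauge Ψ k x : ℝ≥0∞) ∂(P.map (X : Ω →ₘ[P] ℝ)) < ∞
    rw [lintegral_map hm (X : Ω →ₘ[P] ℝ).measurable]
    exact X.2 _ (by exact_mod_cast k.pos)

/-- A law-invariant convex risk measure `ρ : H^Ψ → ℝ`. The order on `L⁰` is the almost sure one. -/
structure IsLawInvariantConvexRiskMeasure (P : Measure Ω) [IsProbabilityMeasure P]
    (Ψ : YoungFunction) (ρ : orliczHeart P Ψ → ℝ) : Prop where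
  monotonicity : ∀ X Y : orliczHeart P Ψ,
    (∀ᵐ ω ∂P, (X : Ω →ₘ[P] ℝ) ω ≤ (Y : Ω →ₘ[P] ℝ) ω) → ρ Y ≤ ρ X
  convexity : ∀ (X Y : orliczHeart P Ψ) (l : ℝ), 0 ≤ l → l ≤ 1 →
    ρ (l • X + (1 - l) • Y) ≤ l * ρ X + (1 - l) * ρ Y
  lawInvariance : ∀ X Y : orliczHeart P Ψ, law P X = law P Y → ρ X = ρ Y

/-- `R : M_1^{(ψ_k)} → ℝ` is the risk functional of `ρ`: `ρ(X) = R(P ∘ X⁻¹)` for all `X ∈ H^Ψ`. -/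
def IsRiskFunctional (P : Measure Ω) [IsProbabilityMeasure P] (Ψ : YoungFunction)
    (ρ : orliczHeart P Ψ → ℝ) (R : GaugeMeasure (orliczGauge Ψ) → ℝ) : Prop :=
  ∀ X : orliczHeart P Ψ, ρ X = R (heartLaw P Ψ X)

end Orlicz

end RiskFunctional

end

/-! The proof couples all laws on one space. An atomless space carries a uniform variable $U$, and
$X_\mu=q_\mu(U)$, with $q_\mu$ the quantile function, has law $\mu$; it lies in $H^\Psi$ because
membership depends only on the law (`exists_orliczHeart_quantile`). Hence every $\mu$ is a law,
$\mathcal R_\rho(\mu)=\rho(X_\mu)$ is the only candidate, and law invariance makes it a risk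
functional.

For continuity, sequences suffice (`continuous_of_forall_seq`). Weak convergence gives $X_{\mu_n}\to
X_\mu$ a.s. (`tendsto_quantile`); with convergence of the moments $\int\psi_k\,d\mu_n$, generalized
dominated convergence gives $\mathbb E[\Psi(k|X_{\mu_n}-X_\mu|)]\to0$ for all $k$
(`tendsto_modular_sub`).

It remains that a finite monotone convex $\rho$ is continuous for this convergence
(`tendsto_of_modular`), a Namioka–Klee argument: some $W\in H^\Psi$ and a selection of indices
satisfy $(j+1)|X_{n_j}-Y|\le W$, and convexity squeezes
$|\rho(X_{n_j})-\rho(Y)|\le(\rho(Y-W)-\rho(Y))/(j+1)$. -/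

namespace RiskFunctional

open MeasureTheory Set Filter Topology ProbabilityTheory
open scoped NNReal ENNReal

/-! ### A uniform random variable on an atomless space. -/

section Uniform

variable {Ω : Type*} [MeasurableSpace Ω]

/-- Strict inclusion of measurable sets together with strict increase of the measure. -/
def MeasureLT (P : Measure Ω) (A B : Set Ω) : Prop :=
  MeasurableSet A ∧ MeasurableSet B ∧ A ⊆ B ∧ P A < P B

/-- An atomless probability space has an increasing family of measurable sets, indexed by their
measures, which run through `[0, 1]`. -/
theorem exists_measure_chain (P : Measure Ω) [IsProbabilityMeasure P] (hP : Atomless P) :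
    ∃ E : ℝ≥0∞ → Set Ω, (∀ t ≤ 1, MeasurableSet (E t) ∧ P (E t) = t) ∧
      ∀ s t, s ≤ t → t ≤ 1 → E s ⊆ E t := by
  have hc0 : IsChain (MeasureLT P) ({∅, univ} : Set (Set Ω)) := by
    have h : MeasureLT P ∅ univ :=
      ⟨MeasurableSet.empty, MeasurableSet.univ, subset_univ _, by simp⟩
    intro A hA B hB hAB
    rcases hA with rfl | hA <;> rcases hB with rfl | hB
    · exact absurd rfl hAB
    · rw [mem_singleton_iff] at hB; subst hB; exact Or.inl h
    · rw [mem_singleton_iff] at hA; subst hA; exact Or.inr h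
    · rw [mem_singleton_iff] at hA hB; exact absurd (hA.trans hB.symm) hAB
  obtain ⟨M, hM, hcM⟩ := hc0.exists_maxChain
  have h0 : ∅ ∈ M := hcM (by simp)
  have h1 : univ ∈ M := hcM (by simp)
  have hmeas : ∀ A ∈ M, MeasurableSet A := by
    intro A hA
    by_cases hne : A = ∅
    · rw [hne]; exact MeasurableSet.empty
    · rcases hM.1 hA h0 hne with h | h
      · exact h.1
      · exact h.2.1
  have hsub : ∀ A ∈ M, ∀ B ∈ M, P A ≤ P B → A ⊆ B := by
    intro A hA B hB hAB
    by_cases hne : A = B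
    · exact hne.subset
    · rcases hM.1 hA hB hne with h | h
      · exact h.2.2.1
      · exact absurd h.2.2.2 hAB.not_gt
  -- Maximality: a set comparable with every member of the chain already belongs to it.
  have hins : ∀ D, (∀ A ∈ M, MeasureLT P A D ∨ MeasureLT P D A) → D ∈ M := by
    intro D hD
    have : M = insert D M := hM.2 (hM.1.insert fun A hA _ => (hD A hA).symm) (subset_insert _ _)
    rw [this]; exact mem_insert _ _
  have hval : ∀ t ≤ 1, ∃ A ∈ M, P A = t := by
    intro t ht
    by_contra hno
    push Not at hno
    have hcases : ∀ A ∈ M, P A < t ∨ t < P A := fun A hA => lt_or_gt_of_ne (hno A hA)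
    -- If the measures below the missed value `t` had no maximum, an increasing union of chain
    -- members approaching their supremum would be in `M` and attain it.
    have hlow : ∃ A ∈ M, P A < t ∧ ∀ B ∈ M, P B < t → P B ≤ P A := by
      by_contra hcon
      push Not at hcon
      have hne : (P '' {A ∈ M | P A < t}).Nonempty := by
        refine ⟨_, mem_image_of_mem P (show ∅ ∈ {A ∈ M | P A < t} from ⟨h0, ?_⟩)⟩
        rcases hcases ∅ h0 with h | h
        · exact h
        · simp at h
      obtain ⟨u, hu, hlim, hseq⟩ := exists_seq_tendsto_sSup hne (OrderTop.bddAbove _)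
      choose A hA hAu using hseq
      set a := sSup (P '' {A ∈ M | P A < t}) with ha
      have hmono : Monotone A := fun m n hmn =>
        hsub _ (hA m).1 _ (hA n).1 (by rw [hAu, hAu]; exact hu hmn)
      have hPA : P (⋃ n, A n) = a := by
        refine tendsto_nhds_unique (tendsto_measure_iUnion_atTop hmono) ?_
        rwa [show P ∘ A = u from funext hAu]
      have hat : a ≤ t := sSup_le (by rintro _ ⟨B, hB, rfl⟩; exact hB.2.le)
      have hmU : MeasurableSet (⋃ n, A n) := MeasurableSet.iUnion fun n => hmeas _ (hA n).1
      have hmem : (⋃ n, A n) ∈ M := by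
        refine hins _ fun B hB => ?_
        rcases hcases B hB with h | h
        · left
          obtain ⟨C, hC, hCt, hBC⟩ := hcon B hB h
          have hBa : P B < a := hBC.trans_le (le_sSup ⟨C, ⟨hC, hCt⟩, rfl⟩)
          obtain ⟨n, hn⟩ := (hlim.eventually_const_lt hBa).exists
          refine ⟨hmeas B hB, hmU, (hsub B hB _ (hA n).1 ?_).trans (subset_iUnion A n),
            hPA ▸ hBa⟩
          rw [hAu]; exact hn.le
        · right
          exact ⟨hmU, hmeas B hB, iUnion_subset fun n =>
            hsub _ (hA n).1 _ hB ((hA n).2.le.trans h.le), hPA ▸ hat.trans_lt h⟩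
      have hlt : P (⋃ n, A n) < t := lt_of_le_of_ne (hPA ▸ hat) (hno _ hmem)
      obtain ⟨C, hC, hCt, hlt'⟩ := hcon _ hmem hlt
      rw [hPA] at hlt'
      exact hlt'.not_ge (le_sSup ⟨C, ⟨hC, hCt⟩, rfl⟩)
    have hhigh : ∃ A ∈ M, t < P A ∧ ∀ B ∈ M, t < P B → P A ≤ P B := by
      by_contra hcon
      push Not at hcon
      have hne : (P '' {A ∈ M | t < P A}).Nonempty := by
        refine ⟨_, mem_image_of_mem P (show univ ∈ {A ∈ M | t < P A} from ⟨h1, ?_⟩)⟩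
        rcases hcases univ h1 with h | h
        · rw [measure_univ] at h; exact absurd ht h.not_ge
        · exact h
      obtain ⟨u, hu, hlim, hseq⟩ := exists_seq_tendsto_sInf hne (OrderBot.bddBelow _)
      choose A hA hAu using hseq
      set a := sInf (P '' {A ∈ M | t < P A}) with ha
      have hmono : Antitone A := fun m n hmn =>
        hsub _ (hA n).1 _ (hA m).1 (by rw [hAu, hAu]; exact hu hmn)
      have hPA : P (⋂ n, A n) = a := by
        refine tendsto_nhds_unique (tendsto_measure_iInter_atTop
          (fun n => (hmeas _ (hA n).1).nullMeasurableSet) hmono ⟨0, measure_ne_top _ _⟩) ?_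
        rwa [show P ∘ A = u from funext hAu]
      have hat : t ≤ a := le_sInf (by rintro _ ⟨B, hB, rfl⟩; exact hB.2.le)
      have hmU : MeasurableSet (⋂ n, A n) := MeasurableSet.iInter fun n => hmeas _ (hA n).1
      have hmem : (⋂ n, A n) ∈ M := by
        refine hins _ fun B hB => ?_
        rcases hcases B hB with h | h
        · left
          exact ⟨hmeas B hB, hmU, subset_iInter fun n =>
            hsub _ hB _ (hA n).1 (h.le.trans (hA n).2.le), hPA ▸ h.trans_le hat⟩
        · right
          obtain ⟨C, hC, hCt, hBC⟩ := hcon B hB h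
          have hBa : a < P B := (sInf_le ⟨C, ⟨hC, hCt⟩, rfl⟩ : a ≤ P C).trans_lt hBC
          obtain ⟨n, hn⟩ := (hlim.eventually_lt_const hBa).exists
          refine ⟨hmU, hmeas B hB, (iInter_subset A n).trans (hsub _ (hA n).1 B hB ?_),
            hPA ▸ hBa⟩
          rw [hAu]; exact hn.le
      have hlt : t < P (⋂ n, A n) := lt_of_le_of_ne (hPA ▸ hat) (hno _ hmem).symm
      obtain ⟨C, hC, hCt, hlt'⟩ := hcon _ hmem hlt
      rw [hPA] at hlt'
      exact hlt'.not_ge (sInf_le ⟨C, ⟨hC, hCt⟩, rfl⟩)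
    obtain ⟨A, hA, hAt, hAmax⟩ := hlow
    obtain ⟨B, hB, hBt, hBmin⟩ := hhigh
    have hAB : A ⊆ B := hsub A hA B hB (hAt.trans hBt).le
    have hdiff : 0 < P (B \ A) := by
      rw [measure_sdiff hAB (hmeas A hA).nullMeasurableSet (measure_ne_top _ _)]
      exact tsub_pos_of_lt (hAt.trans hBt)
    -- Atomlessness fills the gap: `A ∪ D` lies strictly between the neighbours `A` and `B` of `t`,
    -- against maximality.
    obtain ⟨D, hDsub, hDm, hD0, hDlt⟩ := hP _ ((hmeas B hB).diff (hmeas A hA)) hdiff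
    have hdisj : Disjoint A D := disjoint_left.2 fun x hxA hxD => (hDsub hxD).2 hxA
    have hmAD : MeasurableSet (A ∪ D) := (hmeas A hA).union hDm
    have hPAD : P (A ∪ D) = P A + P D := measure_union hdisj hDm
    have hADB : A ∪ D ⊆ B := union_subset hAB fun x hx => (hDsub hx).1
    have hltA : P A < P (A ∪ D) := by
      rw [hPAD]; exact ENNReal.lt_add_right (measure_ne_top _ _) hD0.ne'
    have hltB : P (A ∪ D) < P B := by
      have : P B = P A + P (B \ A) := by
        rw [← measure_union disjoint_sdiff_right ((hmeas B hB).diff (hmeas A hA)),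
          union_sdiff_cancel hAB]
      rw [hPAD, this]
      exact ENNReal.add_lt_add_left (measure_ne_top _ _) hDlt
    have hmem : A ∪ D ∈ M := by
      refine hins _ fun C hC => ?_
      rcases hcases C hC with h | h
      · exact Or.inl ⟨hmeas C hC, hmAD, (hsub C hC A hA (hAmax C hC h)).trans subset_union_left,
          (hAmax C hC h).trans_lt hltA⟩
      · exact Or.inr ⟨hmAD, hmeas C hC, hADB.trans (hsub B hB C hC (hBmin C hC h)),
          hltB.trans_le (hBmin C hC h)⟩
    rcases hcases _ hmem with h | h
    · exact hltA.not_ge (hAmax _ hmem h)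
    · exact hltB.not_ge (hBmin _ hmem h)
  choose! E hE hPE using hval
  refine ⟨E, fun t ht => ⟨hmeas _ (hE t ht), hPE t ht⟩, fun s t hst ht =>
    hsub _ (hE s (hst.trans ht)) _ (hE t ht) ?_⟩
  rw [hPE s (hst.trans ht), hPE t ht]
  exact hst

/-- An atomless probability space carries a random variable that is uniform on `(0, 1]`. -/
theorem exists_uniform (P : Measure Ω) [IsProbabilityMeasure P] (hP : Atomless P) :
    ∃ U : Ω → ℝ, Measurable U ∧ P.map U = volume.restrict (Ioc 0 1) := by
  classical
  obtain ⟨E, hE, hmono⟩ := exists_measure_chain P hP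
  let I := {q : ℚ // 0 ≤ q ∧ q ≤ 1}
  have : Nonempty I := ⟨⟨0, by norm_num⟩⟩
  have hI0 : ∀ q : I, (0 : ℝ) ≤ (q : ℚ) := fun q => by exact_mod_cast q.2.1
  have hI1 : ∀ q : I, ((q : ℚ) : ℝ) ≤ 1 := fun q => by exact_mod_cast q.2.2
  have hI1' : ∀ q : I, ENNReal.ofReal (q : ℚ) ≤ 1 := fun q => ENNReal.ofReal_le_one.2 (hI1 q)
  -- The infimum of the `V q` is the least level at which `ω` enters the chain; the value 1 off the
  -- set makes non-membership harmless, and rational levels keep the infimum measurable.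
  let V : I → Ω → ℝ := fun q => (E (ENNReal.ofReal (q : ℚ))).piecewise (fun _ => (q : ℚ)) 1
  have hV0 : ∀ q ω, 0 ≤ V q ω := by
    intro q ω
    simp only [V, Set.piecewise]
    split_ifs
    · exact hI0 q
    · simp
  have hV1 : ∀ q ω, V q ω ≤ 1 := by
    intro q ω
    simp only [V, Set.piecewise]
    split_ifs
    · exact hI1 q
    · simp
  have hVm : ∀ q, Measurable (V q) := fun q =>
    Measurable.piecewise (hE _ (hI1' q)).1 measurable_const measurable_one
  let U : Ω → ℝ := fun ω => ⨅ q, V q ω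
  have hUm : Measurable U := Measurable.iInf hVm
  have hbdd : ∀ ω, BddBelow (range fun q => V q ω) := fun ω =>
    ⟨0, by rintro _ ⟨q, rfl⟩; exact hV0 q ω⟩
  have hU0 : ∀ ω, 0 ≤ U ω := fun ω => le_ciInf fun q => hV0 q ω
  have hU1 : ∀ ω, U ω ≤ 1 := fun ω => (ciInf_le (hbdd ω) ⟨0, by norm_num⟩).trans (hV1 _ ω)
  have hlt : ∀ x : ℝ, x ≤ 1 → P {ω | U ω < x} ≤ ENNReal.ofReal x := by
    intro x hx
    rw [← (hE (ENNReal.ofReal x) (ENNReal.ofReal_le_one.2 hx)).2]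
    refine measure_mono fun ω hω => ?_
    obtain ⟨q, hq⟩ := exists_lt_of_ciInf_lt (show ⨅ q, V q ω < x from hω)
    simp only [V, Set.piecewise] at hq
    split_ifs at hq with h
    · exact hmono _ _ (ENNReal.ofReal_le_ofReal hq.le) (ENNReal.ofReal_le_one.2 hx) h
    · exact absurd hx (not_le.2 hq)
  have hle : ∀ x : ℝ, 0 ≤ x → x < 1 → P {ω | U ω ≤ x} = ENNReal.ofReal x := by
    intro x hx0 hx
    apply le_antisymm
    · refine ge_of_tendsto (x := 𝓝[>] x) (f := ENNReal.ofReal)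
        ((ENNReal.continuous_ofReal.tendsto x).mono_left nhdsWithin_le_nhds) ?_
      filter_upwards [Ioc_mem_nhdsGT hx] with y hy
      exact (measure_mono fun ω (hω : U ω ≤ x) => hω.trans_lt hy.1).trans (hlt y hy.2)
    · refine le_of_forall_lt fun c hc => ?_
      obtain ⟨q, hq0, hcq, hqx⟩ := ENNReal.lt_iff_exists_rat_btwn.1 hc
      have hqx' : (q : ℝ) < x := by
        by_contra hcon
        push Not at hcon
        refine hqx.not_ge ?_
        exact ENNReal.ofReal_le_ofReal (by simpa [Real.toNNReal] using hcon)
      have hq1 : q ≤ 1 := by exact_mod_cast (hqx'.trans hx).le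
      refine hcq.trans_le ?_
      have := (hE _ (hI1' ⟨q, hq0, hq1⟩)).2
      change _ = ((q : ℝ).toNNReal : ℝ≥0∞) at this
      rw [← this]
      refine measure_mono fun ω hω => ?_
      refine (ciInf_le (hbdd ω) ⟨q, hq0, hq1⟩).trans ?_
      simp only [V]
      rw [Set.piecewise_eq_of_mem _ _ _ hω]
      exact hqx'.le
  refine ⟨U, hUm, ?_⟩
  have := Measure.isProbabilityMeasure_map (μ := P) hUm.aemeasurable
  refine Measure.ext_of_Iic _ _ fun x => ?_
  rw [Measure.map_apply hUm measurableSet_Iic, Measure.restrict_apply measurableSet_Iic]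
  change P {ω | U ω ≤ x} = _
  have hinter : Iic x ∩ Ioc 0 1 = Ioc 0 (min x 1) := by
    ext y; simp only [mem_inter_iff, mem_Iic, mem_Ioc, le_min_iff]; tauto
  rw [hinter, Real.volume_Ioc, sub_zero]
  rcases lt_or_ge x 0 with hx | hx
  · rw [min_eq_left (by linarith), ENNReal.ofReal_of_nonpos hx.le]
    convert measure_empty (μ := P)
    ext ω
    simpa using hx.trans_le (hU0 ω)
  rcases lt_or_ge x 1 with hx1 | hx1
  · rw [hle x hx hx1, min_eq_left hx1.le]
  · rw [min_eq_right hx1, ENNReal.ofReal_one]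
    convert measure_univ (μ := P)
    ext ω
    simpa using (hU1 ω).trans hx1

end Uniform

/-! ### Quantile functions and their convergence. -/

section Quantile

/-- The lower quantile function of a probability measure on `ℝ`. -/
noncomputable def quantile (μ : Measure ℝ) (u : ℝ) : ℝ := sInf {x | u ≤ cdf μ x}

/-- Right continuity of the cdf makes the infimum attained. Levels 0 and 1 are left out since there
the set may be unbounded below or empty, where `sInf` takes a default value. -/
theorem quantile_le_iff (μ : Measure ℝ) {u : ℝ} (hu : u ∈ Ioo (0 : ℝ) 1) (x : ℝ) :
    quantile μ u ≤ x ↔ u ≤ cdf μ x := by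
  have hbdd : BddBelow {x | u ≤ cdf μ x} := by
    obtain ⟨b, hb⟩ := ((tendsto_cdf_atBot μ).eventually_lt_const hu.1).exists
    exact ⟨b, fun y (hy : u ≤ cdf μ y) =>
      le_of_lt ((monotone_cdf μ).reflect_lt (hb.trans_le hy))⟩
  have hne : {x | u ≤ cdf μ x}.Nonempty := by
    obtain ⟨b, hb⟩ := ((tendsto_cdf_atTop μ).eventually_const_lt hu.2).exists
    exact ⟨b, hb.le⟩
  refine ⟨fun h => ?_, fun h => csInf_le hbdd h⟩
  have hright : Tendsto (cdf μ) (𝓝[>] x) (𝓝 (cdf μ x)) :=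
    ((cdf μ).right_continuous x).tendsto.mono_left (nhdsWithin_mono _ Ioi_subset_Ici_self)
  refine ge_of_tendsto hright ?_
  filter_upwards [self_mem_nhdsWithin] with y hy
  obtain ⟨z, hz, hzy⟩ := exists_lt_of_csInf_lt hne (lt_of_le_of_lt h hy)
  exact le_trans hz (monotone_cdf μ hzy.le)

variable {Ω : Type*} [MeasurableSpace Ω] {P : Measure Ω} {U : Ω → ℝ}

theorem ae_mem_Ioo_of_uniform (hU : Measurable U)
    (hPU : P.map U = volume.restrict (Ioc 0 1)) : ∀ᵐ ω ∂P, U ω ∈ Ioo (0 : ℝ) 1 := by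
  have : ∀ᵐ u ∂(P.map U), u ∈ Ioo (0 : ℝ) 1 := by
    rw [hPU, ← restrict_Ioo_eq_restrict_Ioc]
    exact ae_restrict_mem measurableSet_Ioo
  exact ae_of_ae_map hU.aemeasurable this

theorem ae_notMem_countable_of_uniform (hU : Measurable U)
    (hPU : P.map U = volume.restrict (Ioc 0 1)) {s : Set ℝ} (hs : s.Countable) :
    ∀ᵐ ω ∂P, U ω ∉ s := by
  have : ∀ᵐ u ∂(P.map U), u ∉ s := by
    rw [hPU]
    exact ae_restrict_of_ae (hs.ae_notMem volume)
  exact ae_of_ae_map hU.aemeasurable this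

theorem quantile_monotoneOn (μ : Measure ℝ) : MonotoneOn (quantile μ) (Ioo 0 1) := by
  intro u hu v hv huv
  exact (quantile_le_iff μ hu _).2 (huv.trans ((quantile_le_iff μ hv _).1 le_rfl))

theorem aemeasurable_quantile_comp (μ : Measure ℝ) (hU : Measurable U)
    (hPU : P.map U = volume.restrict (Ioc 0 1)) :
    AEMeasurable (fun ω => quantile μ (U ω)) P := by
  have : AEMeasurable (quantile μ) (P.map U) := by
    rw [hPU, ← restrict_Ioo_eq_restrict_Ioc]
    exact aemeasurable_restrict_of_monotoneOn measurableSet_Ioo (quantile_monotoneOn μ)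
  exact this.comp_measurable hU

theorem map_quantile_comp (μ : Measure ℝ) [IsProbabilityMeasure μ] [IsProbabilityMeasure P]
    (hU : Measurable U) (hPU : P.map U = volume.restrict (Ioc 0 1)) :
    P.map (fun ω => quantile μ (U ω)) = μ := by
  have hm := aemeasurable_quantile_comp μ hU hPU
  have := Measure.isProbabilityMeasure_map hm
  refine Measure.ext_of_Iic _ _ fun x => ?_
  rw [Measure.map_apply_of_aemeasurable hm measurableSet_Iic]
  have h1 : P ((fun ω => quantile μ (U ω)) ⁻¹' Iic x) = P (U ⁻¹' Iic (cdf μ x)) := by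
    refine measure_congr ?_
    filter_upwards [ae_mem_Ioo_of_uniform hU hPU] with ω hω
    exact propext (quantile_le_iff μ hω x)
  rw [h1, ← Measure.map_apply hU measurableSet_Iic, hPU,
    Measure.restrict_apply measurableSet_Iic, ← ofReal_cdf]
  have hinter : Iic (cdf μ x) ∩ Ioc 0 1 = Ioc 0 (cdf μ x) := by
    ext y
    simp only [mem_inter_iff, mem_Iic, mem_Ioc]
    exact ⟨fun h => ⟨h.2.1, h.1⟩, fun h => ⟨h.2, h.1, h.2.trans (cdf_le_one μ x)⟩⟩
  rw [hinter, Real.volume_Ioc, sub_zero]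

/-- A finite measure has countably many atoms, while an interval has positive length. This supplies
continuity points of the cdf. -/
theorem exists_measure_singleton_eq_zero_mem_Ioo (μ : Measure ℝ) [IsFiniteMeasure μ] {a b : ℝ}
    (hab : a < b) : ∃ x ∈ Ioo a b, μ {x} = 0 := by
  have hc : {x : ℝ | 0 < μ {x}}.Countable := by
    simpa using! Measure.countable_meas_level_set_pos (μ := μ) (measurable_id (α := ℝ))
  by_contra hcon
  push Not at hcon
  have hsub : Ioo a b ⊆ {x : ℝ | 0 < μ {x}} := fun x hx => pos_iff_ne_zero.2 (hcon x hx)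
  have h0 := (hc.mono hsub).measure_zero volume
  rw [Real.volume_Ioo, ENNReal.ofReal_eq_zero] at h0
  linarith

theorem tendsto_cdf_of_tendsto {ι : Type*} {l : Filter ι} {μs : ι → ProbabilityMeasure ℝ}
    {μ : ProbabilityMeasure ℝ} (h : Tendsto μs l (𝓝 μ)) {x : ℝ} (hx : (μ : Measure ℝ) {x} = 0) :
    Tendsto (fun i => cdf (μs i : Measure ℝ) x) l (𝓝 (cdf (μ : Measure ℝ) x)) := by
  simp only [cdf_eq_real, measureReal_def]
  refine (ENNReal.tendsto_toReal (measure_ne_top _ _)).comp ?_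
  exact ProbabilityMeasure.tendsto_measure_of_null_frontier_of_tendsto' h (by simpa using hx)

/-- Weak convergence implies convergence of quantiles at all but countably many levels. -/
theorem tendsto_quantile {ι : Type*} {l : Filter ι} {μs : ι → ProbabilityMeasure ℝ}
    {μ : ProbabilityMeasure ℝ} (h : Tendsto μs l (𝓝 μ)) {u : ℝ} (hu : u ∈ Ioo (0 : ℝ) 1)
    (hu' : u ∉ range fun q : ℚ => cdf (μ : Measure ℝ) q) :
    Tendsto (fun i => quantile (μs i : Measure ℝ) u) l (𝓝 (quantile (μ : Measure ℝ) u)) := by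
  refine tendsto_order.2 ⟨fun a ha => ?_, fun b hb => ?_⟩
  · obtain ⟨x, hx, hx0⟩ := exists_measure_singleton_eq_zero_mem_Ioo (μ : Measure ℝ) ha
    have hlt : cdf (μ : Measure ℝ) x < u := by
      rw [← not_le, ← quantile_le_iff _ hu, not_le]; exact hx.2
    filter_upwards [(tendsto_cdf_of_tendsto h hx0).eventually_lt_const hlt] with i hi
    rw [← not_le, ← quantile_le_iff _ hu, not_le] at hi
    exact hx.1.trans hi
  -- The upper bound fails only if the cdf is flat at height `u` to the right of the quantile; such
  -- a stretch contains a rational, which `hu'` rules out.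
  · obtain ⟨q, hq1, hq2⟩ := exists_rat_btwn hb
    obtain ⟨x, hx, hx0⟩ := exists_measure_singleton_eq_zero_mem_Ioo (μ : Measure ℝ) hq2
    have hlt : u < cdf (μ : Measure ℝ) x :=
      (lt_of_le_of_ne ((quantile_le_iff _ hu _).1 hq1.le) fun he => hu' ⟨q, he.symm⟩).trans_le
        (monotone_cdf _ hx.1.le)
    filter_upwards [(tendsto_cdf_of_tendsto h hx0).eventually_const_lt hlt] with i hi
    exact ((quantile_le_iff _ hu _).2 hi.le).trans_lt hx.2

end Quantile

/-! ### Continuity of convex risk measures on the Orlicz heart. -/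

section HeartContinuity

variable {Ω : Type*} [MeasurableSpace Ω] {P : Measure Ω} {Ψ : YoungFunction}

theorem continuous_orliczGauge (Ψ : YoungFunction) (k : ℕ+) : Continuous (orliczGauge Ψ k) :=
  Ψ.continuous'.comp (continuous_const.mul continuous_nnnorm)

theorem measurable_orliczGauge (Ψ : YoungFunction) (k : ℕ+) :
    Measurable fun x : ℝ => (orliczGauge Ψ k x : ℝ≥0∞) :=
  (continuous_orliczGauge Ψ k).measurable.coe_nnreal_ennreal

theorem orliczGauge_zero (Ψ : YoungFunction) (k : ℕ+) : orliczGauge Ψ k 0 = 0 := by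
  simp [orliczGauge, Ψ.map_zero']

theorem lintegral_orliczGauge_lt_top (X : orliczHeart P Ψ) (k : ℕ+) :
    ∫⁻ ω, (orliczGauge Ψ k ((X : Ω →ₘ[P] ℝ) ω) : ℝ≥0∞) ∂P < ∞ :=
  X.2 _ (by exact_mod_cast k.pos)

theorem exists_orliczHeart_ae_eq {f : Ω → ℝ} (hf : AEMeasurable f P)
    (h : ∀ k, ∫⁻ ω, (orliczGauge Ψ k (f ω) : ℝ≥0∞) ∂P < ∞) :
    ∃ X : orliczHeart P Ψ, (X : Ω →ₘ[P] ℝ) =ᵐ[P] f := by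
  have hmk := AEEqFun.coeFn_mk f hf.aestronglyMeasurable
  refine ⟨⟨AEEqFun.mk f hf.aestronglyMeasurable, fun c _ => ?_⟩, hmk⟩
  obtain ⟨n, hn⟩ := exists_nat_ge c
  refine lt_of_le_of_lt (lintegral_mono_ae ?_) (h n.succPNat)
  filter_upwards [hmk] with ω hω
  rw [hω]
  have hle : c ≤ ((n.succPNat : ℕ) : ℝ≥0) := hn.trans (by simp)
  exact_mod_cast Ψ.monotone' (mul_le_mul_left hle _)

theorem YoungFunction.exists_le_of_le (Ψ : YoungFunction) (C : ℝ≥0) :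
    ∃ K : ℝ≥0, ∀ x, Ψ x ≤ C → x ≤ K := by
  obtain ⟨K, hK⟩ := eventually_atTop.1 (Ψ.tendsto'.eventually_gt_atTop C)
  refine ⟨K, fun x hx => ?_⟩
  by_contra hcon
  exact (hK x (not_le.1 hcon).le).not_ge hx

/-- A sequence in the Orlicz heart that tends to zero in all modulars has rescaled elements which
share an upper bound in the Orlicz heart. -/
theorem exists_orliczHeart_bound (Z : ℕ → orliczHeart P Ψ)
    (hZ : ∀ k : ℕ+, Tendsto
      (fun n => ∫⁻ ω, (orliczGauge Ψ k ((Z n : Ω →ₘ[P] ℝ) ω) : ℝ≥0∞) ∂P) atTop (𝓝 0)) :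
    ∃ (φ : ℕ → ℕ) (W : orliczHeart P Ψ), ∀ᵐ ω ∂P, ∀ j : ℕ,
      ((j : ℝ) + 1) * |(Z (φ j) : Ω →ₘ[P] ℝ) ω| ≤ (W : Ω →ₘ[P] ℝ) ω := by
  -- The factor is `(j + 1)²`: one `j + 1` is the rescaling, the other dominates any fixed `k` once
  -- `j ≥ k`, so that the modulars are summable for every `k`.
  have hex : ∀ j : ℕ, ∃ n, ∫⁻ ω, (orliczGauge Ψ (j.succPNat * j.succPNat)
      ((Z n : Ω →ₘ[P] ℝ) ω) : ℝ≥0∞) ∂P < (2 : ℝ≥0∞)⁻¹ ^ j := fun j =>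
    ((hZ _).eventually_lt_const (ENNReal.pow_pos (by simp) j)).exists
  choose φ hφ using hex
  have hm : ∀ (k : ℕ+) (j : ℕ), Measurable fun ω =>
      (orliczGauge Ψ k ((Z (φ j) : Ω →ₘ[P] ℝ) ω) : ℝ≥0∞) := fun k j =>
    (measurable_orliczGauge Ψ k).comp (Z (φ j) : Ω →ₘ[P] ℝ).measurable
  have hfin : ∀ k : ℕ+, ∫⁻ ω, ∑' j : ℕ, (orliczGauge Ψ (k * j.succPNat)
      ((Z (φ j) : Ω →ₘ[P] ℝ) ω) : ℝ≥0∞) ∂P < ∞ := by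
    intro k
    rw [lintegral_tsum fun j => (hm _ j).aemeasurable]
    rw [← ENNReal.summable.sum_add_tsum_nat_add' (k := (k : ℕ))]
    refine ENNReal.add_lt_top.2 ⟨ENNReal.sum_lt_top.2 fun j _ =>
      lintegral_orliczGauge_lt_top _ _, ?_⟩
    have hle : ∀ j : ℕ, ∫⁻ ω, (orliczGauge Ψ (k * (j + k).succPNat)
        ((Z (φ (j + k)) : Ω →ₘ[P] ℝ) ω) : ℝ≥0∞) ∂P ≤ (2 : ℝ≥0∞)⁻¹ ^ j := by
      intro j
      calc _ ≤ ∫⁻ ω, (orliczGauge Ψ ((j + k).succPNat * (j + k).succPNat)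
            ((Z (φ (j + k)) : Ω →ₘ[P] ℝ) ω) : ℝ≥0∞) ∂P := by
            refine lintegral_mono fun ω => ?_
            have : (k : ℕ) ≤ ((j + k).succPNat : ℕ) := by simp; omega
            refine ENNReal.coe_le_coe.2 (Ψ.monotone' ?_)
            simp only [PNat.mul_coe, Nat.cast_mul]
            gcongr
        _ ≤ (2 : ℝ≥0∞)⁻¹ ^ (j + k) := (hφ _).le
        _ ≤ _ := pow_le_pow_of_le_one zero_le (by simp) (by omega)
    refine (ENNReal.tsum_le_tsum hle).trans_lt ?_
    rw [ENNReal.tsum_geometric, ENNReal.one_sub_inv_two, inv_inv]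
    simp
  let a : Ω → ℕ → ℝ≥0 := fun ω j => ((j.succPNat : ℕ) : ℝ≥0) * ‖(Z (φ j) : Ω →ₘ[P] ℝ) ω‖₊
  have hbdd : ∀ᵐ ω ∂P, BddAbove (range (a ω)) := by
    have hmt : Measurable fun ω => ∑' j : ℕ, (orliczGauge Ψ (1 * j.succPNat)
        ((Z (φ j) : Ω →ₘ[P] ℝ) ω) : ℝ≥0∞) := Measurable.tsum fun j => hm _ j
    filter_upwards [ae_lt_top hmt (hfin 1).ne] with ω hω
    lift (∑' j : ℕ, (orliczGauge Ψ (1 * j.succPNat)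
        ((Z (φ j) : Ω →ₘ[P] ℝ) ω) : ℝ≥0∞)) to ℝ≥0 using hω.ne with C hC
    obtain ⟨K, hK⟩ := Ψ.exists_le_of_le C
    refine ⟨K, ?_⟩
    rintro _ ⟨j, rfl⟩
    refine hK _ ?_
    have := ENNReal.le_tsum (f := fun j : ℕ => (orliczGauge Ψ (1 * j.succPNat)
        ((Z (φ j) : Ω →ₘ[P] ℝ) ω) : ℝ≥0∞)) j
    rw [← hC, ENNReal.coe_le_coe] at this
    simpa [orliczGauge, a] using this
  have ham : ∀ j, Measurable fun ω => a ω j := fun j =>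
    measurable_const.mul (Z (φ j) : Ω →ₘ[P] ℝ).measurable.nnnorm
  -- The candidate for `W` is the supremum of the rescaled elements; where it is unbounded, a null
  -- set by `hbdd`, it has the default value 0.
  have hsm : Measurable fun ω => ((⨆ j, a ω j : ℝ≥0) : ℝ) :=
    (Measurable.iSup ham).coe_nnreal_real
  obtain ⟨W, hW⟩ := exists_orliczHeart_ae_eq (Ψ := Ψ) (P := P) hsm.aemeasurable (fun k => by
    refine lt_of_le_of_lt (lintegral_mono_ae ?_) (hfin k)
    filter_upwards [hbdd] with ω hω
    have hmono : Monotone fun x : ℝ≥0 => (Ψ (((k : ℕ) : ℝ≥0) * x) : ℝ≥0∞) := fun x y hxy =>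
      ENNReal.coe_le_coe.2 (Ψ.monotone' (mul_le_mul_right hxy _))
    have hcont : Continuous fun x : ℝ≥0 => (Ψ (((k : ℕ) : ℝ≥0) * x) : ℝ≥0∞) :=
      ENNReal.continuous_coe.comp (Ψ.continuous'.comp (continuous_const.mul continuous_id))
    -- `Ψ` is continuous and monotone, hence commutes with the supremum, which is then bounded by
    -- the integrable sum.
    have heq := hmono.map_ciSup_of_continuousAt hcont.continuousAt hω
    simp only [orliczGauge, NNReal.nnnorm_eq]
    rw [heq]
    refine iSup_le fun j => ?_
    refine le_trans (le_of_eq ?_) (ENNReal.le_tsum j)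
    simp only [a, PNat.mul_coe, Nat.cast_mul, mul_assoc])
  refine ⟨φ, W, ?_⟩
  filter_upwards [hW, hbdd] with ω hω hb j
  rw [hω]
  have := NNReal.coe_le_coe.2 (le_ciSup hb j)
  simpa [a] using this

variable [IsProbabilityMeasure P] {ρ : orliczHeart P Ψ → ℝ}

/-- A convex risk measure on an Orlicz heart is sequentially continuous for modular convergence. -/
theorem IsLawInvariantConvexRiskMeasure.tendsto_of_modular
    (hρ : IsLawInvariantConvexRiskMeasure P Ψ ρ) {X : ℕ → orliczHeart P Ψ} {Y : orliczHeart P Ψ}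
    (h : ∀ k : ℕ+, Tendsto (fun n => ∫⁻ ω, (orliczGauge Ψ k
      (((X n - Y : orliczHeart P Ψ) : Ω →ₘ[P] ℝ) ω) : ℝ≥0∞) ∂P) atTop (𝓝 0)) :
    Tendsto (fun n => ρ (X n)) atTop (𝓝 (ρ Y)) := by
  -- Only convergence along `ns ∘ φ` is needed, so `φ` need not be monotone.
  refine tendsto_of_subseq_tendsto fun ns hns => ?_
  obtain ⟨φ, W, hW⟩ := exists_orliczHeart_bound (fun n => X (ns n) - Y)
    (fun k => (h k).comp hns)
  refine ⟨φ, ?_⟩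
  have hYW : (((Y - W : orliczHeart P Ψ) : Ω →ₘ[P] ℝ) : Ω → ℝ) =ᵐ[P]
      fun ω => (Y : Ω →ₘ[P] ℝ) ω - (W : Ω →ₘ[P] ℝ) ω := AEEqFun.coeFn_sub _ _
  have hup : ∀ j : ℕ, ρ (Y + ((j : ℝ) + 1) • (X (ns (φ j)) - Y)) ≤ ρ (Y - W) := by
    intro j
    refine hρ.monotonicity _ _ ?_
    have h1 := AEEqFun.coeFn_add (Y : Ω →ₘ[P] ℝ)
      ((((j : ℝ) + 1) • (X (ns (φ j)) - Y) : orliczHeart P Ψ) : Ω →ₘ[P] ℝ)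
    have h2 := AEEqFun.coeFn_smul ((j : ℝ) + 1)
      ((X (ns (φ j)) - Y : orliczHeart P Ψ) : Ω →ₘ[P] ℝ)
    filter_upwards [hW, h1, h2, hYW] with ω hω h1 h2 h3
    refine h3.trans_le (le_trans ?_ h1.ge)
    rw [Pi.add_apply]
    refine le_trans ?_ (add_le_add le_rfl h2.ge)
    rw [Pi.smul_apply, smul_eq_mul]
    have := mul_le_mul_of_nonneg_left (neg_abs_le
      (((X (ns (φ j)) - Y : orliczHeart P Ψ) : Ω →ₘ[P] ℝ) ω)) (by positivity : (0:ℝ) ≤ j + 1)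
    linarith [hω j]
  have hlo : ∀ j : ℕ, ρ (Y + (-((j : ℝ) + 1)) • (X (ns (φ j)) - Y)) ≤ ρ (Y - W) := by
    intro j
    refine hρ.monotonicity _ _ ?_
    have h1 := AEEqFun.coeFn_add (Y : Ω →ₘ[P] ℝ)
      (((-((j : ℝ) + 1)) • (X (ns (φ j)) - Y) : orliczHeart P Ψ) : Ω →ₘ[P] ℝ)
    have h2 := AEEqFun.coeFn_smul (-((j : ℝ) + 1))
      ((X (ns (φ j)) - Y : orliczHeart P Ψ) : Ω →ₘ[P] ℝ)
    filter_upwards [hW, h1, h2, hYW] with ω hω h1 h2 h3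
    refine h3.trans_le (le_trans ?_ h1.ge)
    rw [Pi.add_apply]
    refine le_trans ?_ (add_le_add le_rfl h2.ge)
    rw [Pi.smul_apply, smul_eq_mul]
    have := mul_le_mul_of_nonneg_left (le_abs_self
      (((X (ns (φ j)) - Y : orliczHeart P Ψ) : Ω →ₘ[P] ℝ) ω)) (by positivity : (0:ℝ) ≤ j + 1)
    linarith [hω j]
  have hupper : ∀ j : ℕ, ρ (X (ns (φ j))) ≤ ρ Y + (1 / ((j : ℝ) + 1)) * (ρ (Y - W) - ρ Y) := by
    intro j
    have hj : (0 : ℝ) < j + 1 := by positivity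
    have hl1 : 1 / ((j : ℝ) + 1) ≤ 1 := by
      rw [div_le_one hj]; linarith [(Nat.cast_nonneg j : (0 : ℝ) ≤ j)]
    have hc := hρ.convexity (Y + ((j : ℝ) + 1) • (X (ns (φ j)) - Y)) Y (1 / ((j : ℝ) + 1))
      (by positivity) hl1
    -- `X` lies on the segment from `Y` to the point at `j + 1` times its displacement.
    have he : (1 / ((j : ℝ) + 1)) • (Y + ((j : ℝ) + 1) • (X (ns (φ j)) - Y)) +
        (1 - 1 / ((j : ℝ) + 1)) • Y = X (ns (φ j)) := by
      match_scalars
      · field_simp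
        ring
      · field_simp
    rw [he] at hc
    have := mul_le_mul_of_nonneg_left (hup j) (by positivity : 0 ≤ 1 / ((j : ℝ) + 1))
    linarith
  have hlower : ∀ j : ℕ, ρ Y - (1 / ((j : ℝ) + 1)) * (ρ (Y - W) - ρ Y) ≤ ρ (X (ns (φ j))) := by
    intro j
    have hj : (0 : ℝ) < j + 1 := by positivity
    have hj2 : (0 : ℝ) < j + 2 := by positivity
    have hl1 : 1 / ((j : ℝ) + 2) ≤ 1 := by
      rw [div_le_one hj2]; linarith [(Nat.cast_nonneg j : (0 : ℝ) ≤ j)]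
    have hc := hρ.convexity (Y + (-((j : ℝ) + 1)) • (X (ns (φ j)) - Y)) (X (ns (φ j)))
      (1 / ((j : ℝ) + 2)) (by positivity) hl1
    -- Now `Y` lies between `X` and the reflected point; their displacements `1` and `-(j + 1)`
    -- force the weight `1 / (j + 2)`.
    have he : (1 / ((j : ℝ) + 2)) • (Y + (-((j : ℝ) + 1)) • (X (ns (φ j)) - Y)) +
        (1 - 1 / ((j : ℝ) + 2)) • X (ns (φ j)) = Y := by
      match_scalars <;> field_simp <;> ring
    rw [he] at hc
    have h1 := mul_le_mul_of_nonneg_left (hlo j) (by positivity : 0 ≤ 1 / ((j : ℝ) + 2))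
    have h2 : ρ Y ≤ 1 / ((j : ℝ) + 2) * ρ (Y - W) +
        (1 - 1 / ((j : ℝ) + 2)) * ρ (X (ns (φ j))) := by linarith
    have h3 := mul_le_mul_of_nonneg_left h2 hj2.le
    have h4 : ((j : ℝ) + 2) * ρ Y ≤ ρ (Y - W) + ((j : ℝ) + 1) * ρ (X (ns (φ j))) := by
      refine h3.trans_eq ?_
      field_simp
      ring
    have h5 : ρ Y - 1 / ((j : ℝ) + 1) * (ρ (Y - W) - ρ Y) =
        (((j : ℝ) + 2) * ρ Y - ρ (Y - W)) / (j + 1) := by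
      field_simp
      ring
    rw [h5, div_le_iff₀ hj]
    linarith
  have hz := (tendsto_one_div_add_atTop_nhds_zero_nat (𝕜 := ℝ)).mul_const (ρ (Y - W) - ρ Y)
  rw [zero_mul] at hz
  refine tendsto_of_tendsto_of_tendsto_of_le_of_le ?_ ?_ hlower hupper
  · simpa using hz.const_sub (ρ Y)
  · simpa using hz.const_add (ρ Y)

end HeartContinuity

/-! ### Dominated convergence with varying bounds. -/

section GeneralizedDominatedConvergence

variable {Ω : Type*} [MeasurableSpace Ω] {P : Measure Ω}

/-- Dominated convergence to zero with a convergent sequence of dominating functions. -/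
theorem tendsto_lintegral_zero_of_le_of_tendsto {F G : ℕ → Ω → ℝ≥0∞} {g : Ω → ℝ≥0∞}
    (hF : ∀ n, AEMeasurable (F n) P) (hG : ∀ n, AEMeasurable (G n) P) (hg : AEMeasurable g P)
    (hFG : ∀ n, F n ≤ᵐ[P] G n) (hF0 : ∀ᵐ ω ∂P, Tendsto (fun n => F n ω) atTop (𝓝 0))
    (hGg : ∀ᵐ ω ∂P, Tendsto (fun n => G n ω) atTop (𝓝 (g ω))) (hgi : ∫⁻ ω, g ω ∂P ≠ ∞)
    (hGi : Tendsto (fun n => ∫⁻ ω, G n ω ∂P) atTop (𝓝 (∫⁻ ω, g ω ∂P))) :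
    Tendsto (fun n => ∫⁻ ω, F n ω ∂P) atTop (𝓝 0) := by
  have h1 : Tendsto (fun n => ∫⁻ ω, min (F n ω) (g ω) ∂P) atTop (𝓝 0) := by
    have := tendsto_lintegral_of_dominated_convergence' (μ := P) (f := fun _ => 0) g
      (fun n => (hF n).min hg) (fun n => ae_of_all _ fun ω => min_le_right _ _) hgi
      (by filter_upwards [hF0] with ω hω; simpa using hω.min (tendsto_const_nhds (x := g ω)))
    simpa using this
  have h2 : Tendsto (fun n => ∫⁻ ω, min (G n ω) (g ω) ∂P) atTop (𝓝 (∫⁻ ω, g ω ∂P)) :=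
    tendsto_lintegral_of_dominated_convergence' (μ := P) g
      (fun n => (hG n).min hg) (fun n => ae_of_all _ fun ω => min_le_right _ _) hgi
      (by filter_upwards [hGg] with ω hω; simpa using hω.min (tendsto_const_nhds (x := g ω)))
  have h3 : Tendsto (fun n => ∫⁻ ω, (G n ω - min (G n ω) (g ω)) ∂P) atTop (𝓝 0) := by
    have heq : ∀ n, ∫⁻ ω, (G n ω - min (G n ω) (g ω)) ∂P =
        ∫⁻ ω, G n ω ∂P - ∫⁻ ω, min (G n ω) (g ω) ∂P := fun n =>
      lintegral_sub' ((hG n).min hg)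
        (ne_top_of_le_ne_top hgi (lintegral_mono fun ω => min_le_right _ _))
        (ae_of_all _ fun ω => min_le_left _ _)
    simp only [heq]
    simpa using ENNReal.Tendsto.sub hGi h2 (Or.inl hgi)
  refine tendsto_of_tendsto_of_tendsto_of_le_of_le tendsto_const_nhds
    (by simpa using h1.add h3) (fun n => zero_le) fun n => ?_
  -- Pointwise `F ≤ min F g + (G - min G g)`: the part below `g` vanishes by ordinary domination,
  -- the excess by convergence of the integrals of `G`.
  refine le_trans (lintegral_mono_ae ?_) (lintegral_add_left' ((hF n).min hg) _).le
  filter_upwards [hFG n] with ω hω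
  rcases le_total (F n ω) (g ω) with h | h
  · rw [min_eq_left h]; exact le_self_add
  · rw [min_eq_right h, min_eq_right (h.trans hω), add_tsub_cancel_of_le (h.trans hω)]
    exact hω

end GeneralizedDominatedConvergence

/-! ### Sequential test for the gauge weak topology. -/

section GaugeTopology

variable {E ι : Type*} [TopologicalSpace E]

theorem gauge_mem_gaugeBounded {φ : E → ℝ≥0} (hφ : Continuous φ) :
    (fun x => (φ x : ℝ)) ∈ gaugeBounded φ := by
  refine ⟨NNReal.continuous_coe.comp hφ, 1, ?_⟩
  rintro _ ⟨x, rfl⟩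
  have h0 : (0 : ℝ) ≤ φ x := (φ x).2
  change |(φ x : ℝ) / (1 + φ x)| ≤ 1
  rw [abs_of_nonneg (by positivity), div_le_one (by positivity)]
  linarith

theorem boundedContinuousFunction_mem_gaugeBounded (φ : E → ℝ≥0)
    (f : BoundedContinuousFunction E ℝ) : ⇑f ∈ gaugeBounded φ := by
  refine ⟨f.continuous, ‖f‖, ?_⟩
  rintro _ ⟨x, rfl⟩
  have h0 : (0 : ℝ) ≤ φ x := (φ x).2
  change |f x / (1 + φ x)| ≤ ‖f‖
  rw [abs_div, abs_of_nonneg (by positivity : (0 : ℝ) ≤ 1 + φ x)]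
  exact (div_le_self (abs_nonneg _) (by linarith)).trans (f.norm_coe_le_norm x)

variable [MeasurableSpace E]

theorem continuous_integral_gaugeMeasure {ψ : ι → E → ℝ≥0} {k : ι} {f : E → ℝ}
    (hf : f ∈ gaugeBounded (ψ k)) :
    Continuous fun μ : GaugeMeasure ψ => ∫ x, f x ∂(μ.toProb : Measure E) := by
  rw [continuous_iff_le_induced]
  exact iInf_le_of_le k (iInf_le _ (⟨f, hf⟩ : gaugeBounded (ψ k)))

/-- Bounded continuous functions lie in every `gaugeBounded (ψ k)`, so this topology refines the
weak one. -/
theorem continuous_toProb [OpensMeasurableSpace E] [Nonempty ι] (ψ : ι → E → ℝ≥0) :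
    Continuous (GaugeMeasure.toProb : GaugeMeasure ψ → ProbabilityMeasure E) := by
  refine continuous_iff_continuousAt.2 fun μ => ?_
  refine ProbabilityMeasure.tendsto_iff_forall_integral_tendsto.2 fun f => ?_
  exact (continuous_integral_gaugeMeasure
    (boundedContinuousFunction_mem_gaugeBounded (ψ (Classical.arbitrary ι)) f)).tendsto μ

/-- Continuity of a function for the gauge weak topology may be tested on sequences which converge
weakly and along which the integrals of the gauge functions converge. -/
theorem continuous_of_forall_seq {X : Type*} [TopologicalSpace X] {ψ : ℕ+ → ℝ → ℝ≥0}
    (hψ : ∀ k, Continuous (ψ k)) {R : GaugeMeasure ψ → X}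
    (h : ∀ (μs : ℕ → GaugeMeasure ψ) (μ : GaugeMeasure ψ),
      Tendsto (fun n => (μs n).toProb) atTop (𝓝 μ.toProb) →
      (∀ k, Tendsto (fun n => ∫⁻ x, (ψ k x : ℝ≥0∞) ∂((μs n).toProb : Measure ℝ)) atTop
        (𝓝 (∫⁻ x, (ψ k x : ℝ≥0∞) ∂(μ.toProb : Measure ℝ)))) →
      Tendsto (fun n => R (μs n)) atTop (𝓝 (R μ))) : Continuous R := by
  -- The target of `J` is first countable, so sequences decide convergence along the filter pulled
  -- back by `J`. As `J` is continuous, that filter is coarser than `𝓝 μ`, and convergence along it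
  -- is enough.
  let J : GaugeMeasure ψ → ProbabilityMeasure ℝ × (ℕ+ → ℝ) := fun μ =>
    (μ.toProb, fun k => ∫ x, (ψ k x : ℝ) ∂(μ.toProb : Measure ℝ))
  have hJ : Continuous J := (continuous_toProb ψ).prodMk (continuous_pi fun k =>
    continuous_integral_gaugeMeasure (gauge_mem_gaugeBounded (hψ k)))
  have hreal : ∀ (μ : GaugeMeasure ψ) k, ∫ x, (ψ k x : ℝ) ∂(μ.toProb : Measure ℝ) =
      (∫⁻ x, (ψ k x : ℝ≥0∞) ∂(μ.toProb : Measure ℝ)).toReal := by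
    intro μ k
    rw [integral_eq_lintegral_of_nonneg_ae (f := fun x => (ψ k x : ℝ))
      (ae_of_all _ fun x => (ψ k x).2) (NNReal.continuous_coe.comp (hψ k)).aestronglyMeasurable]
    simp
  refine continuous_iff_continuousAt.2 fun μ => ?_
  have hle : 𝓝 μ ≤ comap J (𝓝 (J μ)) := hJ.tendsto μ |>.le_comap
  have key : Tendsto R (comap J (𝓝 (J μ))) (𝓝 (R μ)) := by
    refine tendsto_of_seq_tendsto fun μs hμs => ?_
    have hlim : Tendsto (J ∘ μs) atTop (𝓝 (J μ)) := tendsto_comap_iff.1 hμs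
    rw [nhds_prod_eq] at hlim
    refine h μs μ hlim.fst fun k => ?_
    have hk := tendsto_pi_nhds.1 hlim.snd k
    simp only [J, Function.comp, hreal] at hk
    exact (ENNReal.tendsto_toReal_iff (fun n => ((μs n).lintegral_lt_top k).ne)
      (μ.lintegral_lt_top k).ne).1 hk
  exact key.mono_left hle

end GaugeTopology

/-! ### From almost sure convergence to modular convergence. -/

section ModularConvergence

variable {Ω : Type*} [MeasurableSpace Ω] {P : Measure Ω} {Ψ : YoungFunction}

theorem orliczGauge_sub_le (Ψ : YoungFunction) (k : ℕ+) (x y : ℝ) :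
    orliczGauge Ψ k (x - y) ≤ orliczGauge Ψ (2 * k) x + orliczGauge Ψ (2 * k) y := by
  calc orliczGauge Ψ k (x - y)
      ≤ Ψ (((k : ℕ) : ℝ≥0) * ‖x‖₊ + ((k : ℕ) : ℝ≥0) * ‖y‖₊) :=
        Ψ.monotone' (by rw [← mul_add]; gcongr; exact nnnorm_sub_le _ _)
    _ ≤ _ := by simpa [orliczGauge, mul_assoc] using Ψ.add_le _ _

/-- Almost sure convergence and convergence of all modulars imply modular convergence. -/
theorem tendsto_modular_sub {X : ℕ → orliczHeart P Ψ} {Y : orliczHeart P Ψ}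
    (hae : ∀ᵐ ω ∂P, Tendsto (fun n => (X n : Ω →ₘ[P] ℝ) ω) atTop (𝓝 ((Y : Ω →ₘ[P] ℝ) ω)))
    (hmod : ∀ k : ℕ+, Tendsto
      (fun n => ∫⁻ ω, (orliczGauge Ψ k ((X n : Ω →ₘ[P] ℝ) ω) : ℝ≥0∞) ∂P) atTop
      (𝓝 (∫⁻ ω, (orliczGauge Ψ k ((Y : Ω →ₘ[P] ℝ) ω) : ℝ≥0∞) ∂P))) (k : ℕ+) :
    Tendsto (fun n => ∫⁻ ω, (orliczGauge Ψ k
      (((X n - Y : orliczHeart P Ψ) : Ω →ₘ[P] ℝ) ω) : ℝ≥0∞) ∂P) atTop (𝓝 0) := by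
  have hm : ∀ (k : ℕ+) (Z : orliczHeart P Ψ), Measurable fun ω =>
      (orliczGauge Ψ k ((Z : Ω →ₘ[P] ℝ) ω) : ℝ≥0∞) := fun k Z =>
    (measurable_orliczGauge Ψ k).comp (Z : Ω →ₘ[P] ℝ).measurable
  have hcont : ∀ k, Continuous fun x : ℝ => (orliczGauge Ψ k x : ℝ≥0∞) := fun k =>
    ENNReal.continuous_coe.comp (continuous_orliczGauge Ψ k)
  have hcoe : ∀ n, (((X n - Y : orliczHeart P Ψ) : Ω →ₘ[P] ℝ) : Ω → ℝ) =ᵐ[P]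
      fun ω => (X n : Ω →ₘ[P] ℝ) ω - (Y : Ω →ₘ[P] ℝ) ω := fun n => AEEqFun.coeFn_sub _ _
  -- The dominating functions come from `orliczGauge_sub_le`; the doubled index is harmless since
  -- the modulars converge for every index.
  refine tendsto_lintegral_zero_of_le_of_tendsto
    (G := fun n ω => (orliczGauge Ψ (2 * k) ((X n : Ω →ₘ[P] ℝ) ω) : ℝ≥0∞) +
      orliczGauge Ψ (2 * k) ((Y : Ω →ₘ[P] ℝ) ω))
    (g := fun ω => (orliczGauge Ψ (2 * k) ((Y : Ω →ₘ[P] ℝ) ω) : ℝ≥0∞) +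
      orliczGauge Ψ (2 * k) ((Y : Ω →ₘ[P] ℝ) ω))
    (fun n => (hm _ _).aemeasurable) (fun n => ((hm _ _).add (hm _ _)).aemeasurable)
    ((hm _ _).add (hm _ _)).aemeasurable ?_ ?_ ?_ ?_ ?_
  · intro n
    filter_upwards [hcoe n] with ω hω
    rw [hω]
    exact_mod_cast orliczGauge_sub_le Ψ k _ _
  · filter_upwards [hae, ae_all_iff.2 hcoe] with ω hω hc
    simp only [hc]
    have h0 : Tendsto (fun n => (X n : Ω →ₘ[P] ℝ) ω - (Y : Ω →ₘ[P] ℝ) ω) atTop (𝓝 0) := by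
      simpa using hω.sub_const ((Y : Ω →ₘ[P] ℝ) ω)
    simpa [orliczGauge_zero, Function.comp_def] using ((hcont k).tendsto 0).comp h0
  · filter_upwards [hae] with ω hω
    exact (((hcont (2 * k)).tendsto _).comp hω).add tendsto_const_nhds
  · rw [lintegral_add_left (hm _ _)]
    have := (lintegral_orliczGauge_lt_top Y (2 * k)).ne
    exact ENNReal.add_ne_top.2 ⟨this, this⟩
  · simp only [lintegral_add_right _ (hm _ Y)]
    exact (hmod (2 * k)).add tendsto_const_nhds

end ModularConvergence

/-! ### Quantile representatives and continuity of the risk functional. -/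

section Representation

variable {Ω : Type*} [MeasurableSpace Ω] {P : Measure Ω} [IsProbabilityMeasure P]
  {Ψ : YoungFunction} {U : Ω → ℝ}

/-- Integrability of the gauges passes from `μ` to the representative by change of variables. The
explicit form records that one `U` serves all laws, as almost sure convergence requires. -/
theorem exists_orliczHeart_quantile (hU : Measurable U)
    (hPU : P.map U = volume.restrict (Ioc 0 1)) (μ : GaugeMeasure (orliczGauge Ψ)) :
    ∃ X : orliczHeart P Ψ,
      (X : Ω →ₘ[P] ℝ) =ᵐ[P] (fun ω => quantile (μ.toProb : Measure ℝ) (U ω)) ∧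
      heartLaw P Ψ X = μ := by
  have hm := aemeasurable_quantile_comp (μ.toProb : Measure ℝ) hU hPU
  have hmap := map_quantile_comp (μ.toProb : Measure ℝ) hU hPU
  obtain ⟨X, hX⟩ := exists_orliczHeart_ae_eq (Ψ := Ψ) hm fun k => by
    have := μ.lintegral_lt_top k
    rw [← hmap, lintegral_map' (measurable_orliczGauge Ψ k).aemeasurable hm] at this
    exact this
  refine ⟨X, hX, ?_⟩
  rcases μ with ⟨μ, hμ⟩
  have : law P X = μ := Subtype.ext ((Measure.map_congr hX).trans hmap)
  subst this
  rfl

theorem lintegral_heartLaw (X : orliczHeart P Ψ) (k : ℕ+) :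
    ∫⁻ x, (orliczGauge Ψ k x : ℝ≥0∞) ∂((heartLaw P Ψ X).toProb : Measure ℝ) =
      ∫⁻ ω, (orliczGauge Ψ k ((X : Ω →ₘ[P] ℝ) ω) : ℝ≥0∞) ∂P :=
  lintegral_map (measurable_orliczGauge Ψ k) (X : Ω →ₘ[P] ℝ).measurable

theorem IsRiskFunctional.continuous {ρ : orliczHeart P Ψ → ℝ} (hP : Atomless P)
    (hρ : IsLawInvariantConvexRiskMeasure P Ψ ρ) {R : GaugeMeasure (orliczGauge Ψ) → ℝ}
    (hR : IsRiskFunctional P Ψ ρ R) : Continuous R := by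
  obtain ⟨U, hU, hPU⟩ := exists_uniform P hP
  choose X hXq hX using exists_orliczHeart_quantile (P := P) (Ψ := Ψ) hU hPU
  have hRX : ∀ μ, R μ = ρ (X μ) := fun μ => by rw [hR (X μ), hX]
  refine continuous_of_forall_seq (continuous_orliczGauge Ψ) fun μs μ hw hmod => ?_
  simp only [hRX]
  refine hρ.tendsto_of_modular (tendsto_modular_sub ?_ fun k => ?_)
  · filter_upwards [hXq μ, ae_all_iff.2 fun n => hXq (μs n), ae_mem_Ioo_of_uniform hU hPU,
      ae_notMem_countable_of_uniform hU hPU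
        (countable_range fun q : ℚ => cdf (μ.toProb : Measure ℝ) q)] with ω h1 h2 h3 h4
    simp only [h1, h2]
    exact tendsto_quantile hw h3 h4
  · simp only [← lintegral_heartLaw, hX]
    exact hmod k

end Representation

end RiskFunctional

/-- The three parts of the conclusion: every element of `M_1^{(ψ_k)}` is the law of an element of
`H^Ψ` (so the two sets of measures coincide); `ρ` has exactly one risk functional on this set; and
the risk functional is continuous for the `(ψ_k)`-weak topology. -/
theorem mainTheorem3 {Ω : Type*} [MeasurableSpace Ω]
    (P : MeasureTheory.Measure Ω) [MeasureTheory.IsProbabilityMeasure P]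
    (hP : RiskFunctional.Atomless P) (Ψ : RiskFunctional.YoungFunction)
    (ρ : RiskFunctional.orliczHeart P Ψ → ℝ)
    (hρ : RiskFunctional.IsLawInvariantConvexRiskMeasure P Ψ ρ) :
    Set.range (RiskFunctional.heartLaw P Ψ) = Set.univ ∧
    (∃! R : RiskFunctional.GaugeMeasure (RiskFunctional.orliczGauge Ψ) → ℝ,
      RiskFunctional.IsRiskFunctional P Ψ ρ R) ∧
    ∀ R : RiskFunctional.GaugeMeasure (RiskFunctional.orliczGauge Ψ) → ℝ,
      RiskFunctional.IsRiskFunctional P Ψ ρ R → Continuous R := by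
  obtain ⟨U, hU, hPU⟩ := RiskFunctional.exists_uniform P hP
  choose X _ hX using
    RiskFunctional.exists_orliczHeart_quantile (P := P) (Ψ := Ψ) hU hPU
  refine ⟨Set.range_eq_univ.2 fun μ => ⟨X μ, hX μ⟩, ⟨fun μ => ρ (X μ), fun Y => ?_, ?_⟩,
    fun R hR => hR.continuous hP hρ⟩
  -- `Y` and the representative of its law may differ, but they share that law.
  · refine hρ.lawInvariance _ _ ?_
    exact (congrArg RiskFunctional.GaugeMeasure.toProb (hX (RiskFunctional.heartLaw P Ψ Y))).symm
  · intro R hR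
    funext μ
    rw [hR (X μ), hX]
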